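/- Let $n\ge 2$, let $\mathbb{H}^n$ be the hyperbolic space of constant sectional curvature $-1$, and let $\mathbb{H}^n\times\mathbb{R}$ carry the product metric. Let $M$ be a connected complete Riemannian manifold of dimension $n$ (without boundary) and let $\varphi:M\to\mathbb{H}^n\times\mathbb{R}$ be a smooth isometric immersion. Let $\alpha$ be its second fundamental form and $|H|=\frac1n\|\operatorname{tr}\alpha\|$ the absolute value of its mean curvature. Suppose that $\sup_M|H|\le\frac{n-1}{n}$ and that $\varphi(M)$ is contained in a vertical cylinder, i.e. that there are $o\in\mathbb{H}^n$ and $r\in\mathbb{R}$ with $\operatorname{dist}_{\mathbb{H}^n}(o,p(\varphi(q)))\le r$ for all $q\in M$, where $p:\mathbb{H}^n\times\mathbb{R}\to\mathbb{H}^n$ is the projection. Then $M$ is non-parabolic: there is a non-constant $C^2$ function $u:M\to\mathbb{R}$ that is bounded above and subharmonic ($\Delta u\ge 0$ for the Laplace–Beltrami operator $\Delta$ of $M$). -/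

import Mathlib

open scoped Manifold ContDiff Bundle

noncomputable section

/-- The coordinate space `ℝⁿ`. -/
abbrev Coord (n : ℕ) : Type := EuclideanSpace ℝ (Fin n)

/-! ### Riemannian geometry in coordinates

A Riemannian metric on an open subset of a vector space `E` is a function `g` that assigns to a
point `x` the bilinear form `g x`. Values of `g` outside the open subset play no role. -/

section Coordinates

variable {E : Type*} [NormedAddCommGroup E] [NormedSpace ℝ E]

/-- Christoffel symbols of the first kind:
`z ↦ (∂ᵥ g(w, z) + ∂_w g(v, z) - ∂_z g(v, w)) / 2`. -/
def christoffelLower (g : E → E →L[ℝ] E →L[ℝ] ℝ) (x v w : E) : E →L[ℝ] ℝ :=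
  (1 / 2 : ℝ) • (fderiv ℝ g x v w + fderiv ℝ g x w v - ((fderiv ℝ g x).flip v).flip w)

/-- Christoffel symbols of the second kind of the Levi-Civita connection of `g`: the vector
`Γ(v, w)` with `g(Γ(v, w), z) = (∂ᵥ g(w, z) + ∂_w g(v, z) - ∂_z g(v, w)) / 2` for all `z`. -/
def christoffel (g : E → E →L[ℝ] E →L[ℝ] ℝ) (x v w : E) : E :=
  (g x).inverse (christoffelLower g x v w)

/-- The trace `∑ᵢⱼ gⁱʲ B(eᵢ, eⱼ)` of a bilinear map `B` with respect to an inner product `g`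
on `ℝⁿ`, where `gⁱʲ` is the inverse of the matrix `g(eᵢ, eⱼ)`. -/
def metricTrace {n : ℕ} {F : Type*} [AddCommGroup F] [Module ℝ F]
    (g : Coord n →L[ℝ] Coord n →L[ℝ] ℝ) (B : Coord n → Coord n → F) : F :=
  ∑ i, ∑ j,
    (Matrix.of fun k l : Fin n =>
      g (EuclideanSpace.single k 1) (EuclideanSpace.single l 1))⁻¹ i j •
        B (EuclideanSpace.single i 1) (EuclideanSpace.single j 1)

end Coordinates

/-! ### The product `ℍⁿ × ℝ` in the Poincaré ball model

The points of `ℍⁿ × ℝ` are the pairs `(x, t)` in `ℝⁿ × ℝ` with `‖x‖ < 1`. -/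

/-- The underlying open set of hyperbolic `n`-space: the open unit ball. -/
def hyperbolicSpace (n : ℕ) : Set (Coord n) := Metric.ball 0 1

/-- The Poincaré metric `4 |dx|² / (1 - |x|²)²`, of constant sectional curvature `-1`. -/
def hyperbolicMetric (n : ℕ) (x : Coord n) : Coord n →L[ℝ] Coord n →L[ℝ] ℝ :=
  (4 / (1 - ‖x‖ ^ 2) ^ 2 : ℝ) • (innerSL ℝ : Coord n →L[ℝ] Coord n →L[ℝ] ℝ)

/-- The hyperbolic distance in the Poincaré ball. -/
def hyperbolicDist {n : ℕ} (x y : Coord n) : ℝ :=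
  Real.arcosh (1 + 2 * ‖x - y‖ ^ 2 / ((1 - ‖x‖ ^ 2) * (1 - ‖y‖ ^ 2)))

/-- The product metric of `ℍⁿ × ℝ`. -/
def productMetric (n : ℕ) (z : Coord n × ℝ) :
    (Coord n × ℝ) →L[ℝ] (Coord n × ℝ) →L[ℝ] ℝ :=
  (hyperbolicMetric n z.1).bilinearComp
      (ContinuousLinearMap.fst ℝ (Coord n) ℝ) (ContinuousLinearMap.fst ℝ (Coord n) ℝ)
    + (ContinuousLinearMap.mul ℝ ℝ).bilinearComp
      (ContinuousLinearMap.snd ℝ (Coord n) ℝ) (ContinuousLinearMap.snd ℝ (Coord n) ℝ)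

/-! ### Riemannian manifolds and immersions into `ℍⁿ × ℝ` -/

section Manifolds

variable {n : ℕ} {M : Type*} [TopologicalSpace M] [ChartedSpace (Coord n) M]

/-- A map on `M` read in the preferred chart at `p`. -/
def inChart {F : Type*} (p : M) (u : M → F) (x : Coord n) : F :=
  u ((extChartAt (𝓡 n) p).symm x)

variable [Bundle.RiemannianBundle (fun x : M => TangentSpace (𝓡 n) x)]

/-- The Riemannian metric of `M` read in the preferred chart at `p`. -/
def chartMetric (p : M) (x : Coord n) : Coord n →L[ℝ] Coord n →L[ℝ] ℝ :=
  let q : M := (extChartAt (𝓡 n) p).symm x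
  let D : Coord n →L[ℝ] TangentSpace (𝓡 n) q :=
    mfderiv 𝓘(ℝ, Coord n) (𝓡 n) (extChartAt (𝓡 n) p).symm x
  (innerSL ℝ : TangentSpace (𝓡 n) q →L[ℝ] TangentSpace (𝓡 n) q →L[ℝ] ℝ).bilinearComp D D

/-- The Hessian `∂ᵥ∂_w u - ∂_{Γ(v,w)} u` of `u : M → ℝ` at `p`, in the preferred chart at `p`. -/
def hessian (u : M → ℝ) (p : M) (v w : Coord n) : ℝ :=
  let x := extChartAt (𝓡 n) p p
  fderiv ℝ (fderiv ℝ (inChart p u)) x v w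
    - fderiv ℝ (inChart p u) x (christoffel (chartMetric p) x v w)

/-- The Laplace-Beltrami operator: the trace of the Hessian. -/
def laplaceBeltrami (u : M → ℝ) (p : M) : ℝ :=
  metricTrace (chartMetric p (extChartAt (𝓡 n) p p)) (hessian u p)

variable (n M) in
/-- A Riemannian manifold is parabolic if every `C²` subharmonic function on it that is bounded
above is constant. -/
def IsParabolic : Prop :=
  ∀ u : M → ℝ, ContMDiff (𝓡 n) 𝓘(ℝ, ℝ) 2 u → (∀ p, 0 ≤ laplaceBeltrami (n := n) u p) →
    BddAbove (Set.range u) → ∀ p q, u p = u q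

/-- `φ` is a (smooth) isometric immersion of `M` into `ℍⁿ × ℝ`; as `M` has dimension `n`, it is an
immersed hypersurface with the induced metric. -/
structure IsIsometricImmersion (φ : M → Coord n × ℝ) : Prop where
  mem : ∀ p, (φ p).1 ∈ hyperbolicSpace n
  smooth : ContMDiff (𝓡 n) 𝓘(ℝ, Coord n × ℝ) ∞ φ
  isometric : ∀ (p : M) (v w : TangentSpace (𝓡 n) p),
    productMetric n (φ p) (mfderiv (𝓡 n) 𝓘(ℝ, Coord n × ℝ) φ p v)
      (mfderiv (𝓡 n) 𝓘(ℝ, Coord n × ℝ) φ p w) = inner ℝ v w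

/-- The second fundamental form `α(X, Y) = ∇̄_X Y - ∇_X Y` of an isometric immersion `φ` into
`ℍⁿ × ℝ`, on coordinate vector fields of the preferred chart at `p`, evaluated at `p`; here `∇̄` and
`∇` are the Levi-Civita connections of `ℍⁿ × ℝ` and of `M`. -/
def secondFundamentalForm (φ : M → Coord n × ℝ) (p : M) (v w : Coord n) : Coord n × ℝ :=
  let x := extChartAt (𝓡 n) p p
  let D := fderiv ℝ (inChart p φ) x
  fderiv ℝ (fderiv ℝ (inChart p φ)) x v w
    + christoffel (productMetric n) (φ p) (D v) (D w)
    - D (christoffel (chartMetric p) x v w)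

/-- The trace of the second fundamental form; its length is `n |H|`. -/
def meanCurvatureVector (φ : M → Coord n × ℝ) (p : M) : Coord n × ℝ :=
  metricTrace (chartMetric p (extChartAt (𝓡 n) p p)) (secondFundamentalForm φ p)

/-- The absolute value `|H|` of the (normalized) mean curvature. -/
def absMeanCurvature (φ : M → Coord n × ℝ) (p : M) : ℝ :=
  Real.sqrt (productMetric n (φ p) (meanCurvatureVector φ p) (meanCurvatureVector φ p)) / n

end Manifolds

/-- `φ(M)` lies in a vertical cylinder `B(o, r) × ℝ` over a ball of `ℍⁿ`. -/
def InVerticalCylinder {n : ℕ} {M : Type*} (φ : M → Coord n × ℝ) : Prop :=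
  ∃ o ∈ hyperbolicSpace n, ∃ r : ℝ, ∀ p, hyperbolicDist o (φ p).1 ≤ r

end

/-! The witness is F = cosh dist(o, ·), pulled back to M. On ℍⁿ × ℝ its Hessian is F (ḡ - dt²)
(`hessian_coshDist`) and its gradient has squared length F² - 1 (`norm_coshDistGrad_sq`). By
`hessian_comp`, its Hessian on M is F (g - τ ⊗ τ) + dF(α), where τ is the differential of the
height. Since |τ| ≤ 1, the first term has trace at least (n - 1) F (`le_metricTrace_sub_sq`), while
the trace of the second has absolute value at most √(F² - 1) · n|H| < (n - 1) F. So ΔF > 0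
everywhere. The cylinder bounds F by cosh r, and a constant would have ΔF = 0. -/

/-! ### Traces with respect to an inner product -/

/-- A symmetric positive matrix `A + t tᵀ` with `A` positive semidefinite satisfies
`tᵀ (A + t tᵀ)⁻¹ t ≤ 1`. -/
theorem inv_quadratic_le_one {n : ℕ} (G : Matrix (Fin n) (Fin n) ℝ) (t : Fin n → ℝ)
    (hG : IsUnit G.det) (h : ∀ v, (t ⬝ᵥ v) ^ 2 ≤ v ⬝ᵥ G.mulVec v) :
    t ⬝ᵥ G⁻¹.mulVec t ≤ 1 := by
  -- Testing with v = G⁻¹t turns the hypothesis into s² ≤ s for s = tᵀG⁻¹t.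
  have h1 := h (G⁻¹.mulVec t)
  rw [Matrix.mulVec_mulVec, Matrix.mul_nonsing_inv _ hG, Matrix.one_mulVec,
    dotProduct_comm _ t] at h1
  nlinarith

theorem bilinear_single_matrix {n : ℕ} (g : Coord n →L[ℝ] Coord n →L[ℝ] ℝ) (v : Fin n → ℝ) :
    v ⬝ᵥ (Matrix.of fun k l : Fin n =>
      g (EuclideanSpace.single k 1) (EuclideanSpace.single l 1)).mulVec v
      = g (WithLp.toLp 2 v) (WithLp.toLp 2 v) := by
  have hv : WithLp.toLp 2 v = ∑ i, v i • (EuclideanSpace.single i 1 : Coord n) := by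
    ext j
    simp [Finset.sum_apply, Pi.single_apply]
  rw [hv]
  simp only [dotProduct, Matrix.mulVec, Matrix.of_apply, map_sum, map_smul,
    sum_apply, smul_apply, smul_eq_mul, Finset.mul_sum]
  rw [Finset.sum_comm]
  refine Finset.sum_congr rfl fun i _ => Finset.sum_congr rfl fun j _ => ?_
  ring

theorem isUnit_det_of_posDef {n : ℕ} (g : Coord n →L[ℝ] Coord n →L[ℝ] ℝ)
    (hpos : ∀ v, v ≠ 0 → 0 < g v v) :
    IsUnit (Matrix.of fun k l : Fin n =>
      g (EuclideanSpace.single k 1) (EuclideanSpace.single l 1)).det := by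
  rw [isUnit_iff_ne_zero]
  intro h0
  obtain ⟨v, hv, hv0⟩ := Matrix.exists_mulVec_eq_zero_iff.mpr h0
  have h1 := bilinear_single_matrix g v
  rw [hv0, dotProduct_zero] at h1
  exact (hpos (WithLp.toLp 2 v) fun h => hv (by simpa using h)).ne h1

/-- The trace of `g - τ ⊗ τ` is at least `n - 1` if `g - τ ⊗ τ` is positive semidefinite. -/
theorem le_metricTrace_sub_sq {n : ℕ} (g : Coord n →L[ℝ] Coord n →L[ℝ] ℝ)
    (hsymm : ∀ v w, g v w = g w v)
    (hpos : ∀ v, v ≠ 0 → 0 < g v v) (τ : Coord n →L[ℝ] ℝ) (hτ : ∀ v, τ v ^ 2 ≤ g v v) :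
    (n : ℝ) - 1 ≤ metricTrace g fun v w => g v w - τ v * τ w := by
  set G := Matrix.of fun k l : Fin n =>
    g (EuclideanSpace.single k 1) (EuclideanSpace.single l 1) with hGdef
  have hG : IsUnit G.det := isUnit_det_of_posDef g hpos
  set t : Fin n → ℝ := fun i => τ (EuclideanSpace.single i 1) with ht
  have h1 : t ⬝ᵥ G⁻¹.mulVec t ≤ 1 := by
    refine inv_quadratic_le_one G t hG fun v => ?_
    rw [hGdef, bilinear_single_matrix g v]
    refine le_trans (le_of_eq ?_) (hτ _)
    have hv : WithLp.toLp 2 v = ∑ i, v i • (EuclideanSpace.single i 1 : Coord n) := by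
      ext j
      simp [Finset.sum_apply, Pi.single_apply]
    rw [hv, map_sum]
    simp [dotProduct, ht, mul_comm]
  -- The trace of g is tr(G⁻¹G) = n; that of τ ⊗ τ is |τ|², bounded by `h1`.
  have h2 : metricTrace g (fun v w => g v w - τ v * τ w)
      = (G⁻¹ * G).trace - t ⬝ᵥ G⁻¹.mulVec t := by
    simp only [metricTrace, Matrix.trace, Matrix.diag, Matrix.mul_apply, dotProduct,
      Matrix.mulVec, ← Finset.sum_sub_distrib, Finset.mul_sum, smul_eq_mul]
    refine Finset.sum_congr rfl fun i _ => Finset.sum_congr rfl fun j _ => ?_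
    rw [show G j i = g (EuclideanSpace.single i 1) (EuclideanSpace.single j 1) from hsymm _ _]
    simp only [ht]
    ring
  rw [h2, Matrix.nonsing_inv_mul _ hG, Matrix.trace_one, Fintype.card_fin]
  linarith

theorem metricTrace_add {n : ℕ} {F : Type*} [AddCommGroup F] [Module ℝ F]
    (g : Coord n →L[ℝ] Coord n →L[ℝ] ℝ) (B C : Coord n → Coord n → F) :
    metricTrace g (fun v w => B v w + C v w) = metricTrace g B + metricTrace g C := by
  simp only [metricTrace, smul_add, Finset.sum_add_distrib]

theorem metricTrace_map {n : ℕ} {F F' : Type*} [AddCommGroup F] [Module ℝ F]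
    [AddCommGroup F'] [Module ℝ F'] (L : F →ₗ[ℝ] F')
    (g : Coord n →L[ℝ] Coord n →L[ℝ] ℝ) (B : Coord n → Coord n → F) :
    metricTrace g (fun v w => L (B v w)) = L (metricTrace g B) := by
  simp only [metricTrace, map_sum, map_smul]

/-! ### Levi-Civita connection of the product metric -/

theorem productMetric_apply {n : ℕ} (z v w : Coord n × ℝ) :
    productMetric n z v w
      = 4 / (1 - ‖z.1‖ ^ 2) ^ 2 * inner ℝ v.1 w.1 + v.2 * w.2 := by
  rfl

theorem one_sub_norm_sq_pos {n : ℕ} {x : Coord n} (hx : x ∈ hyperbolicSpace n) :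
    0 < 1 - ‖x‖ ^ 2 := by
  have h : ‖x‖ < 1 := by simpa [hyperbolicSpace] using hx
  nlinarith [norm_nonneg x]

theorem productMetric_self_pos {n : ℕ} {z : Coord n × ℝ} (hz : z.1 ∈ hyperbolicSpace n)
    {v : Coord n × ℝ} (hv : v ≠ 0) : 0 < productMetric n z v v := by
  have hs := one_sub_norm_sq_pos hz
  have hc : 0 < 4 / (1 - ‖z.1‖ ^ 2) ^ 2 := by positivity
  rw [productMetric_apply, real_inner_self_eq_norm_sq]
  by_cases h1 : v.1 = 0
  · have h2 : v.2 ≠ 0 := fun h => hv (Prod.ext h1 h)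
    have := mul_self_pos.mpr h2
    positivity
  · have := mul_pos hc (pow_pos (norm_pos_iff.mpr h1) 2)
    nlinarith [mul_self_nonneg v.2]

/-- Positivity kills the kernel, and E and its dual have equal dimension. This is needed because
`ContinuousLinearMap.inverse` defaults to 0 on non-invertible maps. -/
theorem isInvertible_of_posDef {E : Type*} [NormedAddCommGroup E] [NormedSpace ℝ E]
    [FiniteDimensional ℝ E] (g : E →L[ℝ] E →L[ℝ] ℝ) (hpos : ∀ v, v ≠ 0 → 0 < g v v) :
    g.IsInvertible := by
  have hinj : Function.Injective (g : E →ₗ[ℝ] E →L[ℝ] ℝ) := by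
    rw [← LinearMap.ker_eq_bot, LinearMap.ker_eq_bot']
    intro v hv
    by_contra h
    have h1 := hpos v h
    rw [show g v = 0 from hv] at h1
    simp at h1
  have hfin : Module.finrank ℝ E = Module.finrank ℝ (E →L[ℝ] ℝ) := by
    rw [← (LinearMap.toContinuousLinearMap (𝕜 := ℝ) (E := E) (F' := ℝ)).finrank_eq]
    exact (Subspace.dual_finrank_eq (K := ℝ) (V := E)).symm
  have : FiniteDimensional ℝ (E →L[ℝ] ℝ) :=
    (LinearMap.toContinuousLinearMap (𝕜 := ℝ) (E := E) (F' := ℝ)).finiteDimensional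
  exact ⟨(LinearEquiv.ofInjectiveOfFinrankEq _ hinj hfin).toContinuousLinearEquiv,
    by ext; rfl⟩

theorem christoffel_eq_of_posDef {E : Type*} [NormedAddCommGroup E] [NormedSpace ℝ E]
    [FiniteDimensional ℝ E] (g : E → E →L[ℝ] E →L[ℝ] ℝ) {x v w Γ : E}
    (hpos : ∀ v, v ≠ 0 → 0 < g x v v) (h : g x Γ = christoffelLower g x v w) :
    christoffel g x v w = Γ := by
  obtain ⟨e, he⟩ := isInvertible_of_posDef (g x) hpos
  rw [christoffel, ← h, ← he, ContinuousLinearMap.inverse_equiv]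
  simp

theorem hasFDerivAt_one_sub_norm_sq {n : ℕ} (z : Coord n × ℝ) :
    HasFDerivAt (fun y : Coord n × ℝ => 1 - ‖y.1‖ ^ 2)
      (-(2 • (innerSL ℝ z.1).comp (ContinuousLinearMap.fst ℝ (Coord n) ℝ))) z :=
  ((hasFDerivAt_fst (𝕜 := ℝ) (p := z)).norm_sq).const_sub 1

theorem hasFDerivAt_smul_const_add_const {E F : Type*} [NormedAddCommGroup E] [NormedSpace ℝ E]
    [NormedAddCommGroup F] [NormedSpace ℝ F] {f : E → ℝ} {f' : E →L[ℝ] ℝ} {z : E}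
    (hf : HasFDerivAt f f' z) (B C : F) :
    HasFDerivAt (fun y => f y • B + C) (f'.smulRight B) z :=
  (hf.smul_const B).add_const C

theorem fderiv_productMetric {n : ℕ} {z : Coord n × ℝ} (hz : z.1 ∈ hyperbolicSpace n)
    (u v w : Coord n × ℝ) :
    fderiv ℝ (productMetric n) z u v w
      = 16 * inner ℝ z.1 u.1 / (1 - ‖z.1‖ ^ 2) ^ 3 * inner ℝ v.1 w.1 := by
  have hs := one_sub_norm_sq_pos hz
  -- Only the conformal factor 4/s², s = 1 - |x|², varies with the point.
  have h0 : HasDerivAt (fun s : ℝ => 4 / s ^ 2) (-8 / (1 - ‖z.1‖ ^ 2) ^ 3) (1 - ‖z.1‖ ^ 2) := by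
    have h := ((hasDerivAt_pow 2 (1 - ‖z.1‖ ^ 2)).inv (by positivity)).const_mul 4
    refine (h.congr_deriv ?_)
    field_simp
    norm_num [mul_comm]
  have h1 := h0.comp_hasFDerivAt z (hasFDerivAt_one_sub_norm_sq z)
  set B : (Coord n × ℝ) →L[ℝ] (Coord n × ℝ) →L[ℝ] ℝ :=
    (innerSL ℝ : Coord n →L[ℝ] Coord n →L[ℝ] ℝ).bilinearComp
      (ContinuousLinearMap.fst ℝ (Coord n) ℝ) (ContinuousLinearMap.fst ℝ (Coord n) ℝ) with hB
  have h2 := hasFDerivAt_smul_const_add_const h1 B ((ContinuousLinearMap.mul ℝ ℝ).bilinearComp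
      (ContinuousLinearMap.snd ℝ (Coord n) ℝ) (ContinuousLinearMap.snd ℝ (Coord n) ℝ))
  have h3 : productMetric n = fun y : Coord n × ℝ => (4 / (1 - ‖y.1‖ ^ 2) ^ 2) • B +
      ((ContinuousLinearMap.mul ℝ ℝ).bilinearComp
      (ContinuousLinearMap.snd ℝ (Coord n) ℝ) (ContinuousLinearMap.snd ℝ (Coord n) ℝ)) := by
    funext y
    rfl
  rw [h3]
  have h4 := congrArg (fun L => L u v w) h2.fderiv
  refine Eq.trans h4 ?_
  change (-8 / (1 - ‖z.1‖ ^ 2) ^ 3 * (-(2 • inner ℝ z.1 u.1))) * inner ℝ v.1 w.1 = _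
  rw [nsmul_eq_mul]
  push_cast
  ring

/-- For a conformal metric e^{2f}|dx|², Γ(v, w) = df(v) w + df(w) v - ⟨v, w⟩ ∇f; here ∇f = 2x / (1 -
|x|²). The ℝ factor is flat, hence the 0. -/
theorem christoffel_productMetric {n : ℕ} {z : Coord n × ℝ} (hz : z.1 ∈ hyperbolicSpace n)
    (v w : Coord n × ℝ) :
    christoffel (productMetric n) z v w =
      ((2 / (1 - ‖z.1‖ ^ 2)) • ((inner ℝ z.1 v.1 : ℝ) • w.1 + (inner ℝ z.1 w.1 : ℝ) • v.1
        - (inner ℝ v.1 w.1 : ℝ) • z.1), 0) := by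
  have hs := one_sub_norm_sq_pos hz
  refine christoffel_eq_of_posDef _ (fun u hu => productMetric_self_pos hz hu) ?_
  refine ContinuousLinearMap.ext fun u => ?_
  simp only [productMetric_apply, christoffelLower, smul_apply,
    sub_apply, add_apply, ContinuousLinearMap.flip_apply,
    fderiv_productMetric hz, inner_smul_left, inner_add_left, inner_sub_left, smul_eq_mul]
  simp only [conj_trivial]
  field_simp
  ring

/-! ### The hyperbolic cosine of the distance to a point -/

/-- The hyperbolic cosine of the hyperbolic distance to `o`. -/
noncomputable def coshDist {n : ℕ} (o x : Coord n) : ℝ :=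
  1 + 2 * ‖o - x‖ ^ 2 / ((1 - ‖o‖ ^ 2) * (1 - ‖x‖ ^ 2))

/-- The Euclidean gradient of `coshDist o`. -/
noncomputable def coshDistGrad {n : ℕ} (o x : Coord n) : Coord n :=
  (4 / (1 - ‖o‖ ^ 2)) •
    ((1 - ‖x‖ ^ 2)⁻¹ • (x - o) + (‖o - x‖ ^ 2 / (1 - ‖x‖ ^ 2) ^ 2) • x)

theorem one_le_coshDist {n : ℕ} {o x : Coord n} (ho : o ∈ hyperbolicSpace n)
    (hx : x ∈ hyperbolicSpace n) : 1 ≤ coshDist o x := by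
  have hk := one_sub_norm_sq_pos ho
  have hs := one_sub_norm_sq_pos hx
  have : 0 ≤ 2 * ‖o - x‖ ^ 2 / ((1 - ‖o‖ ^ 2) * (1 - ‖x‖ ^ 2)) := by positivity
  unfold coshDist
  linarith

/-- Turns the cylinder condition into the upper bound for the subharmonic function. -/
theorem coshDist_le_cosh {n : ℕ} {o x : Coord n} (ho : o ∈ hyperbolicSpace n)
    (hx : x ∈ hyperbolicSpace n) {r : ℝ} (h : hyperbolicDist o x ≤ r) :
    coshDist o x ≤ Real.cosh r := by
  have h1 := one_le_coshDist ho hx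
  have h2 : 0 ≤ Real.arcosh (coshDist o x) := Real.arcosh_nonneg h1
  rw [← Real.cosh_arcosh h1, Real.cosh_le_cosh, abs_of_nonneg h2,
    abs_of_nonneg (h2.trans h)]
  exact h

theorem contDiffAt_coshDist {n : ℕ} {o x : Coord n} (ho : o ∈ hyperbolicSpace n)
    (hx : x ∈ hyperbolicSpace n) {m : WithTop ℕ∞} : ContDiffAt ℝ m (coshDist o) x := by
  have hk := one_sub_norm_sq_pos ho
  have hs := one_sub_norm_sq_pos hx
  refine contDiffAt_const.add (ContDiffAt.div ?_ ?_ (by positivity))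
  · exact contDiffAt_const.mul ((contDiffAt_const.sub contDiffAt_id).norm_sq ℝ)
  · exact contDiffAt_const.mul (contDiffAt_const.sub (contDiffAt_id.norm_sq ℝ))

theorem hasFDerivAt_norm_sub_sq {n : ℕ} (o x : Coord n) :
    HasFDerivAt (fun y : Coord n => ‖o - y‖ ^ 2) ((2 : ℝ) • innerSL ℝ (x - o)) x := by
  have h := ((hasFDerivAt_id (𝕜 := ℝ) x).const_sub o).norm_sq
  refine h.congr_fderiv (ContinuousLinearMap.ext fun v => ?_)
  simp

theorem hasFDerivAt_inv_one_sub_norm_sq {n : ℕ} {x : Coord n} (hx : x ∈ hyperbolicSpace n) :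
    HasFDerivAt (fun y : Coord n => (1 - ‖y‖ ^ 2)⁻¹)
      ((2 / (1 - ‖x‖ ^ 2) ^ 2) • innerSL ℝ x) x := by
  have hs := one_sub_norm_sq_pos hx
  have h0 := (hasDerivAt_inv hs.ne').comp_hasFDerivAt x
    (((hasFDerivAt_id (𝕜 := ℝ) x).norm_sq).const_sub 1)
  refine h0.congr_fderiv (ContinuousLinearMap.ext fun v => ?_)
  simp
  ring

theorem hasFDerivAt_coshDist {n : ℕ} {o x : Coord n} (ho : o ∈ hyperbolicSpace n)
    (hx : x ∈ hyperbolicSpace n) :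
    HasFDerivAt (coshDist o) (innerSL ℝ (coshDistGrad o x)) x := by
  have hk := one_sub_norm_sq_pos ho
  have hs := one_sub_norm_sq_pos hx
  have h := (((hasFDerivAt_norm_sub_sq o x).mul (hasFDerivAt_inv_one_sub_norm_sq hx)).const_mul
    (2 / (1 - ‖o‖ ^ 2))).const_add 1
  refine (h.congr_fderiv (ContinuousLinearMap.ext fun v => ?_)).congr_of_eventuallyEq
    (Filter.Eventually.of_forall fun y => ?_)
  · simp [coshDistGrad]
    field_simp
    ring
  · simp only [coshDist, div_eq_mul_inv, mul_inv, Pi.mul_apply]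
    ring

theorem hasFDerivAt_coshDistGrad {n : ℕ} {o x : Coord n} (hx : x ∈ hyperbolicSpace n) :
    ∃ L : Coord n →L[ℝ] Coord n, HasFDerivAt (coshDistGrad o) L x ∧ ∀ v,
      L v = (4 / (1 - ‖o‖ ^ 2)) • ((2 * inner ℝ x v / (1 - ‖x‖ ^ 2) ^ 2) • (x - o)
        + (1 - ‖x‖ ^ 2)⁻¹ • v
        + (2 * inner ℝ (x - o) v / (1 - ‖x‖ ^ 2) ^ 2
          + 4 * ‖o - x‖ ^ 2 * inner ℝ x v / (1 - ‖x‖ ^ 2) ^ 3) • x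
        + (‖o - x‖ ^ 2 / (1 - ‖x‖ ^ 2) ^ 2) • v) := by
  have hs := one_sub_norm_sq_pos hx
  have h1 := hasFDerivAt_inv_one_sub_norm_sq hx
  have h2 := ((h1.smul ((hasFDerivAt_id (𝕜 := ℝ) x).sub_const o)).add
    (((hasFDerivAt_norm_sub_sq o x).mul (h1.mul h1)).smul (hasFDerivAt_id (𝕜 := ℝ) x))).const_smul
      (4 / (1 - ‖o‖ ^ 2))
  refine ⟨_, h2.congr_of_eventuallyEq (Filter.Eventually.of_forall fun y => ?_), fun v => ?_⟩
  · simp only [coshDistGrad, Pi.smul_apply, Pi.add_apply, id, div_eq_mul_inv,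
      sq (1 - ‖y‖ ^ 2), mul_inv]
    rfl
  · ext i
    simp [inner_sub_left]
    field_simp
    ring

/-- Reduces later identities to rational ones in |o|², ⟨x, o⟩ and |x|², which `field_simp` and
`ring` can settle. -/
theorem norm_sub_sq_eq_inner {n : ℕ} (o x : Coord n) :
    ‖o - x‖ ^ 2 = ‖o‖ ^ 2 - 2 * inner ℝ x o + ‖x‖ ^ 2 := by
  rw [norm_sub_sq_real, real_inner_comm]

/-- This is |∇ cosh ρ| = sinh ρ; the factor 4 / (1 - |x|²)² converts the hyperbolic norm of a
differential to the Euclidean one. -/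
theorem norm_coshDistGrad_sq {n : ℕ} {o x : Coord n} (ho : o ∈ hyperbolicSpace n)
    (hx : x ∈ hyperbolicSpace n) :
    ‖coshDistGrad o x‖ ^ 2 = 4 / (1 - ‖x‖ ^ 2) ^ 2 * (coshDist o x ^ 2 - 1) := by
  have hk := one_sub_norm_sq_pos ho
  have hs := one_sub_norm_sq_pos hx
  rw [← real_inner_self_eq_norm_sq]
  simp only [coshDistGrad, coshDist, inner_add_left, inner_add_right, inner_smul_left,
    inner_smul_right, inner_sub_left, inner_sub_right, real_inner_self_eq_norm_sq,
    norm_sub_sq_eq_inner, real_inner_comm x o, conj_trivial]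
  field_simp
  ring

/-- Cauchy–Schwarz on the hyperbolic factor; the vertical component of v only enlarges the right
side. -/
theorem inner_coshDistGrad_sq_le {n : ℕ} {o x : Coord n} (ho : o ∈ hyperbolicSpace n)
    (hx : x ∈ hyperbolicSpace n) (v : Coord n × ℝ) (t : ℝ) :
    (inner ℝ (coshDistGrad o x) v.1) ^ 2
      ≤ (coshDist o x ^ 2 - 1) * productMetric n (x, t) v v := by
  have h1 : (inner ℝ (coshDistGrad o x) v.1) ^ 2 ≤ ‖coshDistGrad o x‖ ^ 2 * ‖v.1‖ ^ 2 := by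
    rw [← mul_pow, sq_le_sq, abs_of_nonneg (by positivity : 0 ≤ ‖coshDistGrad o x‖ * ‖v.1‖)]
    exact abs_real_inner_le_norm _ _
  have h2 : 0 ≤ coshDist o x ^ 2 - 1 := by nlinarith [one_le_coshDist ho hx]
  rw [norm_coshDistGrad_sq ho hx] at h1
  rw [productMetric_apply, real_inner_self_eq_norm_sq]
  nlinarith [mul_nonneg h2 (mul_self_nonneg v.2)]

/-- The Hessian of the hyperbolic cosine of the distance is `coshDist` times the metric of the
hyperbolic factor. -/
theorem hessian_coshDist {n : ℕ} {o : Coord n} {z : Coord n × ℝ} (ho : o ∈ hyperbolicSpace n)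
    (hz : z.1 ∈ hyperbolicSpace n) (v w : Coord n × ℝ) :
    fderiv ℝ (fderiv ℝ fun y : Coord n × ℝ => coshDist o y.1) z v w
      - fderiv ℝ (fun y : Coord n × ℝ => coshDist o y.1) z (christoffel (productMetric n) z v w)
      = coshDist o z.1 * (productMetric n z v w - v.2 * w.2) := by
  have hk := one_sub_norm_sq_pos ho
  have hs := one_sub_norm_sq_pos hz
  have h1 : ∀ y : Coord n × ℝ, y.1 ∈ hyperbolicSpace n →
      HasFDerivAt (fun y : Coord n × ℝ => coshDist o y.1)
        ((innerSL ℝ (coshDistGrad o y.1)).comp (ContinuousLinearMap.fst ℝ (Coord n) ℝ)) y :=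
    fun y hy => (hasFDerivAt_coshDist ho hy).comp y hasFDerivAt_fst
  -- The gradient formula holds only inside the ball, so it is differentiated as a germ at z.
  have hev : fderiv ℝ (fun y : Coord n × ℝ => coshDist o y.1) =ᶠ[nhds z] fun y =>
      (innerSL ℝ (coshDistGrad o y.1)).comp (ContinuousLinearMap.fst ℝ (Coord n) ℝ) := by
    have hopen : IsOpen {y : Coord n × ℝ | y.1 ∈ hyperbolicSpace n} :=
      Metric.isOpen_ball.preimage continuous_fst
    filter_upwards [hopen.mem_nhds hz] with y hy using (h1 y hy).fderiv
  obtain ⟨L, hL, hLv⟩ := hasFDerivAt_coshDistGrad (o := o) hz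
  have h2 : HasFDerivAt (fun y : Coord n × ℝ =>
      (innerSL ℝ (coshDistGrad o y.1)).comp (ContinuousLinearMap.fst ℝ (Coord n) ℝ)) _ z :=
    (((innerSL ℝ : Coord n →L[ℝ] Coord n →L[ℝ] ℝ).hasFDerivAt.comp z
      (hL.comp z hasFDerivAt_fst)).clm_comp
        (hasFDerivAt_const (ContinuousLinearMap.fst ℝ (Coord n) ℝ) z))
  have h3 : fderiv ℝ (fderiv ℝ fun y : Coord n × ℝ => coshDist o y.1) z v w
      = inner ℝ (L v.1) w.1 := by
    rw [hev.fderiv_eq, h2.fderiv]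
    simp
    rfl
  rw [h3, (h1 z hz).fderiv, christoffel_productMetric hz, hLv, productMetric_apply]
  simp only [ContinuousLinearMap.comp_apply, ContinuousLinearMap.coe_fst', innerSL_apply_apply]
  simp only [coshDistGrad, coshDist, inner_add_left, inner_add_right, inner_smul_left,
    inner_smul_right, inner_sub_left, inner_sub_right, real_inner_self_eq_norm_sq,
    norm_sub_sq_eq_inner, real_inner_comm z.1 o, conj_trivial]
  field_simp
  ring

/-! ### Immersions read in the preferred chart -/

section Charts

variable {n : ℕ} {M : Type*} [TopologicalSpace M] [ChartedSpace (Coord n) M]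

theorem contDiffAt_inChart [IsManifold (𝓡 n) ∞ M] {F : Type*} [NormedAddCommGroup F]
    [NormedSpace ℝ F] {f : M → F} (hf : ContMDiff (𝓡 n) 𝓘(ℝ, F) ∞ f) (p : M) :
    ContDiffAt ℝ ∞ (inChart (n := n) p f) (extChartAt (𝓡 n) p p) := by
  have h1 : ContMDiffAt 𝓘(ℝ, Coord n) (𝓡 n) ∞ (extChartAt (𝓡 n) p).symm
      (extChartAt (𝓡 n) p p) :=
    (contMDiffOn_extChartAt_symm p).contMDiffAt (extChartAt_target_mem_nhds p)
  exact ((hf _).comp _ h1).contDiffAt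

theorem inChart_extChartAt {F : Type*} (p : M) (f : M → F) :
    inChart (n := n) p f (extChartAt (𝓡 n) p p) = f p := by
  rw [inChart, extChartAt_to_inv]

theorem mdifferentiableAt_extChartAt_symm [IsManifold (𝓡 n) ∞ M] (p : M) :
    MDifferentiableAt 𝓘(ℝ, Coord n) (𝓡 n) (extChartAt (𝓡 n) p).symm
      (extChartAt (𝓡 n) p p) :=
  ((contMDiffOn_extChartAt_symm (n := ∞) p).contMDiffAt
    (extChartAt_target_mem_nhds p)).mdifferentiableAt (by simp)

theorem fderiv_inChart [IsManifold (𝓡 n) ∞ M] {F : Type*} [NormedAddCommGroup F]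
    [NormedSpace ℝ F] {f : M → F} (hf : ContMDiff (𝓡 n) 𝓘(ℝ, F) ∞ f) (p : M) (v : Coord n) :
    fderiv ℝ (inChart (n := n) p f) (extChartAt (𝓡 n) p p) v =
      mfderiv (𝓡 n) 𝓘(ℝ, F) f ((extChartAt (𝓡 n) p).symm (extChartAt (𝓡 n) p p))
        (mfderiv 𝓘(ℝ, Coord n) (𝓡 n) (extChartAt (𝓡 n) p).symm (extChartAt (𝓡 n) p p) v) := by
  have h := mfderiv_comp (extChartAt (𝓡 n) p p)
    ((hf.mdifferentiable (by simp)) _) (mdifferentiableAt_extChartAt_symm p)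
  rw [mfderiv_eq_fderiv] at h
  exact congrArg (fun L => L v) h

variable [Bundle.RiemannianBundle (fun x : M => TangentSpace (𝓡 n) x)]

theorem chartMetric_eq_productMetric [IsManifold (𝓡 n) ∞ M] {φ : M → Coord n × ℝ}
    (hφ : IsIsometricImmersion φ) (p : M) (v w : Coord n) :
    chartMetric p (extChartAt (𝓡 n) p p) v w = productMetric n (φ p)
      (fderiv ℝ (inChart (n := n) p φ) (extChartAt (𝓡 n) p p) v)
      (fderiv ℝ (inChart (n := n) p φ) (extChartAt (𝓡 n) p p) w) := by
  rw [fderiv_inChart hφ.smooth, fderiv_inChart hφ.smooth]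
  have h := hφ.isometric ((extChartAt (𝓡 n) p).symm (extChartAt (𝓡 n) p p))
    (mfderiv 𝓘(ℝ, Coord n) (𝓡 n) (extChartAt (𝓡 n) p).symm (extChartAt (𝓡 n) p p) v)
    (mfderiv 𝓘(ℝ, Coord n) (𝓡 n) (extChartAt (𝓡 n) p).symm (extChartAt (𝓡 n) p p) w)
  refine Eq.trans h.symm ?_
  rw [extChartAt_to_inv (I := 𝓡 n) p]

theorem chartMetric_self_pos [IsManifold (𝓡 n) ∞ M] (p : M) {v : Coord n} (hv : v ≠ 0) :
    0 < chartMetric p (extChartAt (𝓡 n) p p) v v := by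
  have hinv := isInvertible_mfderivWithin_extChartAt_symm (I := 𝓡 n)
    (mem_extChartAt_target (I := 𝓡 n) p)
  rw [ModelWithCorners.range_eq_univ, mfderivWithin_univ] at hinv
  have hne : mfderiv 𝓘(ℝ, Coord n) (𝓡 n) (extChartAt (𝓡 n) p).symm (extChartAt (𝓡 n) p p) v
      ≠ 0 := fun h => hv (hinv.injective (h.trans (map_zero _).symm))
  exact real_inner_self_pos.mpr hne

/-- The composition formula for the Hessian: `Hess (f ∘ φ) = Hess f + df ∘ α`. -/
theorem hessian_comp [IsManifold (𝓡 n) ∞ M] {φ : M → Coord n × ℝ}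
    (hφ : ContMDiff (𝓡 n) 𝓘(ℝ, Coord n × ℝ) ∞ φ) {f : Coord n × ℝ → ℝ} {p : M}
    (hf : ContDiffAt ℝ 2 f (φ p)) (v w : Coord n) :
    hessian (fun q => f (φ q)) p v w =
      (fderiv ℝ (fderiv ℝ f) (φ p)
          (fderiv ℝ (inChart (n := n) p φ) (extChartAt (𝓡 n) p p) v)
          (fderiv ℝ (inChart (n := n) p φ) (extChartAt (𝓡 n) p p) w)
        - fderiv ℝ f (φ p) (christoffel (productMetric n) (φ p)
          (fderiv ℝ (inChart (n := n) p φ) (extChartAt (𝓡 n) p p) v)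
          (fderiv ℝ (inChart (n := n) p φ) (extChartAt (𝓡 n) p p) w)))
      + fderiv ℝ f (φ p) (secondFundamentalForm φ p v w) := by
  set x := extChartAt (𝓡 n) p p with hx
  set ψ : Coord n → Coord n × ℝ := inChart (n := n) p φ with hψ
  have hψx : ψ x = φ p := inChart_extChartAt p φ
  have hψs : ContDiffAt ℝ ∞ ψ x := contDiffAt_inChart hφ p
  have hψ2 : ContDiffAt ℝ 2 ψ x := hψs.of_le (WithTop.coe_le_coe.mpr (le_top : (2 : ℕ∞) ≤ ⊤))
  rw [← hψx] at hf
  have hcomp : inChart (n := n) p (fun q => f (φ q)) = fun y => f (ψ y) := rfl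
  have hev : fderiv ℝ (fun y => f (ψ y)) =ᶠ[nhds x]
      fun y => (fderiv ℝ f (ψ y)).comp (fderiv ℝ ψ y) := by
    have e1 := hψ2.continuousAt.eventually (hf.eventually (by simp))
    filter_upwards [e1, hψ2.eventually (by simp)] with y h1 h2
    exact fderiv_comp y (h1.differentiableAt (by simp)) (h2.differentiableAt (by simp))
  have d1 : DifferentiableAt ℝ (fderiv ℝ f) (ψ x) :=
    (hf.fderiv_right (m := 1) (by norm_num)).differentiableAt (by simp)
  have d2 : DifferentiableAt ℝ (fderiv ℝ ψ) x :=
    (hψ2.fderiv_right (m := 1) (by norm_num)).differentiableAt (by simp)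
  have h2 := (d1.hasFDerivAt.comp x
    (hψ2.differentiableAt (by simp)).hasFDerivAt).clm_comp d2.hasFDerivAt
  have h3 : fderiv ℝ (fderiv ℝ fun y => f (ψ y)) x v w =
      fderiv ℝ (fderiv ℝ f) (ψ x) (fderiv ℝ ψ x v) (fderiv ℝ ψ x w)
        + fderiv ℝ f (ψ x) (fderiv ℝ (fderiv ℝ ψ) x v w) := by
    rw [hev.fderiv_eq]
    have h4 := congrArg (fun L => L v w) h2.fderiv
    refine Eq.trans h4 ?_
    simp [add_comm]
  have h5 := hev.self_of_nhds
  -- The ambient Christoffel term added in α cancels the one subtracted in the ambient Hessian,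
  -- leaving the Hessian on M.
  simp only [hessian, secondFundamentalForm, hcomp, ← hx, ← hψ, h3, h5, ← hψx, map_add, map_sub,
    ContinuousLinearMap.comp_apply]
  ring

end Charts

/-! ### The Laplacian of cosh of the distance on M -/

section Laplacian

variable {n : ℕ} {M : Type*} [TopologicalSpace M] [ChartedSpace (Coord n) M]

theorem contMDiff_coshDist_comp {φ : M → Coord n × ℝ}
    (hφ : ContMDiff (𝓡 n) 𝓘(ℝ, Coord n × ℝ) ∞ φ) (hmem : ∀ p, (φ p).1 ∈ hyperbolicSpace n)
    {o : Coord n} (ho : o ∈ hyperbolicSpace n) :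
    ContMDiff (𝓡 n) 𝓘(ℝ, ℝ) 2 fun p => coshDist o (φ p).1 := by
  intro p
  have h1 : ContDiffAt ℝ 2 (fun y : Coord n × ℝ => coshDist o y.1) (φ p) :=
    (contDiffAt_coshDist ho (hmem p)).comp (φ p) contDiffAt_fst
  exact h1.contMDiffAt.comp p ((hφ p).of_le (WithTop.coe_le_coe.mpr (le_top : (2 : ℕ∞) ≤ ⊤)))

variable [Bundle.RiemannianBundle (fun x : M => TangentSpace (𝓡 n) x)]

/-- `cosh ∘ dist(o, ·)` is strictly subharmonic on a hypersurface of `ℍⁿ × ℝ` with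
`n |H| ≤ n - 1`. -/
theorem laplaceBeltrami_coshDist_pos [IsManifold (𝓡 n) ∞ M] (hn : 2 ≤ n) {φ : M → Coord n × ℝ}
    (hφ : IsIsometricImmersion φ) {o : Coord n} (ho : o ∈ hyperbolicSpace n) {p : M}
    (hH : absMeanCurvature φ p ≤ ((n : ℝ) - 1) / n) :
    0 < laplaceBeltrami (n := n) (fun q => coshDist o (φ q).1) p := by
  have hz := hφ.mem p
  have hn' : (2 : ℝ) ≤ n := by exact_mod_cast hn
  set g := chartMetric p (extChartAt (𝓡 n) p p) with hg
  set D := fderiv ℝ (inChart (n := n) p φ) (extChartAt (𝓡 n) p p) with hD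
  have hgD : ∀ v w, g v w = productMetric n (φ p) (D v) (D w) :=
    chartMetric_eq_productMetric hφ p
  -- The differential of the height function in the chart.
  let τ : Coord n →L[ℝ] ℝ := (ContinuousLinearMap.snd ℝ (Coord n) ℝ).comp D
  let dF : Coord n × ℝ →L[ℝ] ℝ := fderiv ℝ (fun y : Coord n × ℝ => coshDist o y.1) (φ p)
  have hdF : dF = (innerSL ℝ (coshDistGrad o (φ p).1)).comp
      (ContinuousLinearMap.fst ℝ (Coord n) ℝ) :=
    ((hasFDerivAt_coshDist ho hz).comp (φ p) hasFDerivAt_fst).fderiv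
  have hhess : hessian (fun q => coshDist o (φ q).1) p = fun v w =>
      (coshDist o (φ p).1 • (LinearMap.id : ℝ →ₗ[ℝ] ℝ)) (g v w - τ v * τ w)
        + (dF : Coord n × ℝ →ₗ[ℝ] ℝ) (secondFundamentalForm φ p v w) := by
    funext v w
    refine (hessian_comp hφ.smooth (f := fun y => coshDist o y.1)
      ((contDiffAt_coshDist ho hz).comp (φ p) contDiffAt_fst) v w).trans ?_
    rw [hessian_coshDist ho hz, hgD]
    rfl
  have htrace : laplaceBeltrami (n := n) (fun q => coshDist o (φ q).1) p =
      coshDist o (φ p).1 * metricTrace g (fun v w => g v w - τ v * τ w)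
        + dF (meanCurvatureVector φ p) := by
    rw [laplaceBeltrami, hhess, metricTrace_add, metricTrace_map, metricTrace_map]
    rfl
  have hle : (n : ℝ) - 1 ≤ metricTrace g (fun v w => g v w - τ v * τ w) := by
    refine le_metricTrace_sub_sq g (fun v w => ?_) (fun v hv => chartMetric_self_pos p hv) τ
      fun v => ?_
    · rw [hgD, hgD, productMetric_apply, productMetric_apply, real_inner_comm, mul_comm (D v).2]
    · rw [hgD, productMetric_apply, real_inner_self_eq_norm_sq]
      have : 0 ≤ 4 / (1 - ‖(φ p).1‖ ^ 2) ^ 2 * ‖(D v).1‖ ^ 2 := by positivity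
      change (D v).2 ^ 2 ≤ _
      nlinarith
  have hF := one_le_coshDist ho hz
  set F := coshDist o (φ p).1
  set T := meanCurvatureVector φ p with hT
  have hTnorm : productMetric n (φ p) T T ≤ ((n : ℝ) - 1) ^ 2 := by
    rw [absMeanCurvature, div_le_div_iff_of_pos_right (by linarith), ← hT] at hH
    exact (Real.sqrt_le_left (by linarith)).mp hH
  have hgrad : dF T ^ 2 ≤ (F ^ 2 - 1) * productMetric n (φ p) T T := by
    rw [hdF]
    exact inner_coshDistGrad_sq_le ho hz T (φ p).2
  -- Strictness comes from F² - 1 < F² together with n - 1 > 0, where n ≥ 2 enters.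
  have hlt : dF T ^ 2 < (F * ((n : ℝ) - 1)) ^ 2 := by
    have h1 : (F ^ 2 - 1) * productMetric n (φ p) T T ≤ (F ^ 2 - 1) * ((n : ℝ) - 1) ^ 2 :=
      mul_le_mul_of_nonneg_left hTnorm (by nlinarith)
    have h2 : 0 < ((n : ℝ) - 1) ^ 2 := by apply pow_pos; linarith
    nlinarith
  have habs := (abs_lt_of_sq_lt_sq' hlt (mul_nonneg (by linarith) (by linarith))).1
  rw [htrace]
  have := mul_le_mul_of_nonneg_left hle (by linarith : 0 ≤ F)
  linarith

theorem laplaceBeltrami_const (c : ℝ) (p : M) :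
    laplaceBeltrami (n := n) (fun _ : M => c) p = 0 := by
  have h : inChart (n := n) p (fun _ : M => c) = fun _ => c := rfl
  have h' : hessian (n := n) (fun _ : M => c) p = fun _ _ => 0 := by
    funext v w
    simp [hessian, h]
  simp [laplaceBeltrami, metricTrace, h']

end Laplacian

/-! ### Non-parabolicity -/

theorem theorem2 (n : ℕ) (hn : 2 ≤ n)
    (M : Type*) [MetricSpace M] [CompleteSpace M] [ConnectedSpace M]
    [ChartedSpace (Coord n) M] [IsManifold (𝓡 n) ∞ M]
    [Bundle.RiemannianBundle (fun x : M => TangentSpace (𝓡 n) x)]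
    [IsContMDiffRiemannianBundle (𝓡 n) ∞ (Coord n) (fun x : M => TangentSpace (𝓡 n) x)]
    [IsRiemannianManifold (𝓡 n) M]
    (φ : M → Coord n × ℝ) (hφ : IsIsometricImmersion φ)
    (hH : ∀ p, absMeanCurvature φ p ≤ ((n : ℝ) - 1) / n)
    (hcyl : InVerticalCylinder φ) :
    ¬ IsParabolic n M := by
  intro hpar
  obtain ⟨o, ho, r, hr⟩ := hcyl
  -- `ConnectedSpace` includes nonemptiness.
  obtain ⟨p⟩ : Nonempty M := inferInstance
  have hpos : ∀ q, 0 < laplaceBeltrami (n := n) (fun q => coshDist o (φ q).1) q :=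
    fun q => laplaceBeltrami_coshDist_pos hn hφ ho (hH q)
  have hconst := hpar (fun q => coshDist o (φ q).1)
    (contMDiff_coshDist_comp hφ.smooth hφ.mem ho) (fun q => (hpos q).le)
    ⟨Real.cosh r, by
      rintro _ ⟨q, rfl⟩
      exact coshDist_le_cosh ho (hφ.mem q) (hr q)⟩
  have heq : (fun q => coshDist o (φ q).1) = fun _ => coshDist o (φ p).1 :=
    funext fun q => hconst q p
  have := hpos p
  rw [heq, laplaceBeltrami_const] at this
  exact this.false
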